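/- Let $k=k(n)\ge 1$ $(n=1,2,\ldots)$ be positive integers with $k(n)=O(n)$ as $n\to\infty$. The Kneser graph $K(2n+k,n)$ has as vertices the $n$-element subsets of a set of $2n+k$ elements, two being adjacent iff they are disjoint; let $P_n$ be the transition matrix of the simple random walk on $K(2n+k(n),n)$ (move to a uniformly chosen neighbour). For every $n\ge 1$ this chain is ergodic (irreducible and aperiodic), and its unique stationary distribution is the uniform distribution $\pi_n$. Put $d_n(t)=\max_x\max_A|P_n^{\lfloor t\rfloor}(x,A)-\pi_n(A)|$ for real $t\ge 0$ (with $d_n(t)=d_n(0)$ for $t<0$), where $x$ ranges over vertices and $A$ over sets of vertices, and $t^{(n)}_{\mathrm{mix}}(\varepsilon)=\min\{t\in\mathbb N: d_n(t)<\varepsilon\}$. Then the sequence of walks exhibits a total-variation cutoff, that is, $$\lim_{n\to\infty}\frac{t^{(n)}_{\mathrm{mix}}(\varepsilon)}{t^{(n)}_{\mathrm{mix}}(1-\varepsilon)}=1\quad\text{for every } 0<\varepsilon<1,$$ and the cutoff occurs at time $t_n=\frac12\log_{1+k/n}(2n+k)$ with a window of size $w_n=n/k$, that is, $w_n=o\big(t^{(n)}_{\mathrm{mix}}(1/4)\big)$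 and $$\lim_{\lambda\to\infty}\liminf_{n\to\infty}d_n(t_n-\lambda w_n)=1,\qquad \lim_{\lambda\to\infty}\limsup_{n\to\infty}d_n(t_n+\lambda w_n)=0.$$ -/

import Mathlib

open Filter Topology Asymptotics

noncomputable section

/-! Finite Markov chains in discrete time, given by a transition matrix -/

section MarkovChain

variable {Ω : Type*} [Fintype Ω] [DecidableEq Ω]

/-- `P` is the transition matrix of an ergodic (irreducible and aperiodic) chain. Aperiodicity:
for every state `x`, the greatest common divisor of the possible return times to `x` is `1`. -/
structure IsErgodicChain (P : Matrix Ω Ω ℝ) : Prop where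
  stochastic : P ∈ Matrix.rowStochastic ℝ Ω
  irreducible : ∀ x y : Ω, ∃ t : ℕ, 0 < (P ^ t) x y
  aperiodic : ∀ (x : Ω) (d : ℕ), (∀ t : ℕ, 1 ≤ t → 0 < (P ^ t) x x → d ∣ t) → d = 1

/-- `μ` is a probability distribution on the state space that is stationary for `P`. -/
structure IsStationaryDist (P : Matrix Ω Ω ℝ) (μ : Ω → ℝ) : Prop where
  nonneg : ∀ x, 0 ≤ μ x
  sum_eq_one : ∑ x, μ x = 1
  stationary : Matrix.vecMul μ P = μ

/-- Total variation distance `max_{A ⊆ Ω} |μ(A) - ν(A)|`. -/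
def tvDist (μ ν : Ω → ℝ) : ℝ :=
  ⨆ A : Finset Ω, |∑ x ∈ A, μ x - ∑ x ∈ A, ν x|

/-- `d(t) = max_x ‖P^t(x, ·) - π‖_TV` for an integer time `t`. -/
def worstTV (P : Matrix Ω Ω ℝ) (π : Ω → ℝ) (t : ℕ) : ℝ :=
  ⨆ x : Ω, tvDist (fun y => (P ^ t) x y) π

/-- `d(t) = d(⌊t⌋)` for a real time `t` (negative times are read as time `0`). -/
def worstTVReal (P : Matrix Ω Ω ℝ) (π : Ω → ℝ) (t : ℝ) : ℝ :=
  worstTV P π ⌊t⌋₊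

/-- `t_mix(ε) = min {t : d(t) < ε}`. -/
def mixTime (P : Matrix Ω Ω ℝ) (π : Ω → ℝ) (ε : ℝ) : ℕ :=
  sInf {t : ℕ | worstTV P π t < ε}

end MarkovChain

section Cutoff

variable {Ω : ℕ → Type} [∀ n, Fintype (Ω n)] [∀ n, DecidableEq (Ω n)]

/-- The sequence of chains `P n` with stationary distributions `π n` exhibits a cutoff. -/
def HasCutoff (P : ∀ n, Matrix (Ω n) (Ω n) ℝ) (π : ∀ n, Ω n → ℝ) : Prop :=
  ∀ ε : ℝ, 0 < ε → ε < 1 →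
    Tendsto (fun n => (mixTime (P n) (π n) ε : ℝ) / (mixTime (P n) (π n) (1 - ε) : ℝ))
      atTop (𝓝 1)

/-- The sequence of chains has a cutoff at time `τ n` with a window of size `w n`. -/
structure HasCutoffAt (P : ∀ n, Matrix (Ω n) (Ω n) ℝ) (π : ∀ n, Ω n → ℝ)
    (τ w : ℕ → ℝ) : Prop where
  window : w =o[atTop] fun n => (mixTime (P n) (π n) (1 / 4) : ℝ)
  before : Tendsto
    (fun c : ℝ => liminf (fun n => worstTVReal (P n) (π n) (τ n - c * w n)) atTop)
    atTop (𝓝 1)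
  after : Tendsto
    (fun c : ℝ => limsup (fun n => worstTVReal (P n) (π n) (τ n + c * w n)) atTop)
    atTop (𝓝 0)

end Cutoff

/-- Transition matrix of the simple random walk on a finite graph. -/
def srwMatrix {V : Type*} [Fintype V] (G : SimpleGraph V) [DecidableRel G.Adj] :
    Matrix V V ℝ :=
  fun x y => if G.Adj x y then 1 / (G.degree x : ℝ) else 0

/-- The uniform distribution on a finite set. -/
def uniformDist (V : Type*) [Fintype V] : V → ℝ :=
  fun _ => 1 / (Fintype.card V : ℝ)

/-- The `n`-element subsets of a ground set with `2n + k` elements. -/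
abbrev KneserVertex (n k : ℕ) : Type :=
  {A : Finset (Fin (2 * n + k)) // A.card = n}

/-- The Kneser graph `K(2n+k, n)`: two `n`-subsets are adjacent iff they are disjoint.
(The condition `A ≠ B` only matters for `n = 0`.) -/
def kneserGraph (n k : ℕ) : SimpleGraph (KneserVertex n k) where
  Adj A B := A ≠ B ∧ Disjoint A.1 B.1
  symm := ⟨fun _ _ h => ⟨h.1.symm, h.2.symm⟩⟩
  loopless := ⟨fun _ h => h.1 rfl⟩

instance (n k : ℕ) : DecidableRel (kneserGraph n k).Adj :=
  fun A B => inferInstanceAs (Decidable (A ≠ B ∧ Disjoint A.1 B.1))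

/-- Transition matrix of the simple random walk on `K(2n+k, n)`. -/
def kneserWalk (n k : ℕ) : Matrix (KneserVertex n k) (KneserVertex n k) ℝ :=
  srwMatrix (kneserGraph n k)

end

/-!
Let `N = 2n + k` and `q = n / (n + k) = (1 + k/n)⁻¹`, the second largest absolute value of an
eigenvalue of the walk. The cutoff time is chosen so that `q ^ (2 t_n) = 1 / N`, and `c` windows
change `q ^ (2t)` by a factor `(1 + k/n) ^ (2 c n / k)`, which is at least `exp (2c / (1 + C))` when
`k ≤ C n`. So it suffices to show that the distance to equilibrium is small when `N q ^ (2t)` is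
small and close to `1` when `N q ^ (2t)` is large.

*Upper bound.* For `S` a set of points, one step of the walk sends the indicator of `{B | S ⊆ B}`
to `kneserEv n k |S|` times the indicator that `S` avoids the current vertex, and by
inclusion–exclusion the latter is a signed sum of indicators of `{B | T ⊆ B}` with `T ⊆ S`
(`kneserWalk_mulVec_supersetInd`, `sum_powerset_neg_one_pow_supersetInd`). Pairing this triangular
system with an eigenvector shows that every eigenvalue is `(-1) ^ i * kneserEv n k i` for some
`i ≤ n`, and that its eigenspace embeds into functions on `i`-subsets, so its multiplicity is at
most `N.choose i` (`eigenvector_eq_zero`, `card_eigenvalues_le`). As `kneserEv n k i ≤ q ^ i`, the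
trace of the `2t`-th power is at most `(1 + q ^ (2t)) ^ N ≤ exp (N q ^ (2t))`. Permutations of the
ground set act transitively on vertices, so the diagonal of this power is constant, and
Cauchy–Schwarz bounds `d(t) ^ 2` by the trace minus one (`worstTV_kneserWalk_sq_le`). For fixed `n`
the same bound gives convergence to the uniform distribution, hence ergodicity and uniqueness of
the stationary distribution.

*Lower bound.* The centred overlap `f B = |A₀ ∩ B| - q n / (1 + q)` with the starting vertex `A₀` is
an eigenfunction for `-q`, so its mean at time `t` has absolute value at least `q ^ t n / 2`. Its
one-step conditional variance is at most `(1 - q ^ 2) n`, which keeps its variance below `n` at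
all times and in equilibrium; Chebyshev's inequality then gives
`(1 - d(t)) * q ^ (2t) * n ≤ 32` (`one_sub_worstTV_kneserWalk_le`).

The two bounds put every mixing time within `O(n / k)` of `t_n`, and `t_n k / n ≥ log N / 2 → ∞`
yields the cutoff (`hasCutoff_and_hasCutoffAt_of_bounds`).
-/

/-! ### Total variation distance of finite chains -/

section FiniteChain

variable {Ω : Type*}

theorem tvDist_le {μ ν : Ω → ℝ} {c : ℝ}
    (h : ∀ A : Finset Ω, |∑ x ∈ A, μ x - ∑ x ∈ A, ν x| ≤ c) : tvDist μ ν ≤ c :=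
  ciSup_le h

variable [Fintype Ω]

theorem le_tvDist (μ ν : Ω → ℝ) (A : Finset Ω) :
    |∑ x ∈ A, μ x - ∑ x ∈ A, ν x| ≤ tvDist μ ν :=
  le_ciSup (f := fun A : Finset Ω => |∑ x ∈ A, μ x - ∑ x ∈ A, ν x|)
    (Set.finite_range _).bddAbove A

theorem uniformDist_nonneg (x : Ω) : 0 ≤ uniformDist Ω x := by
  unfold uniformDist; positivity

theorem sum_uniformDist [Nonempty Ω] : ∑ x, uniformDist Ω x = 1 := by
  simp [uniformDist]

variable [DecidableEq Ω]

theorem le_worstTV (P : Matrix Ω Ω ℝ) (π : Ω → ℝ) (t : ℕ) (x : Ω) (A : Finset Ω) :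
    |∑ y ∈ A, (P ^ t) x y - ∑ y ∈ A, π y| ≤ worstTV P π t :=
  (le_tvDist _ _ A).trans
    (le_ciSup (f := fun x : Ω => tvDist (fun y => (P ^ t) x y) π)
      (Set.finite_range _).bddAbove x)

theorem worstTV_le [Nonempty Ω] {P : Matrix Ω Ω ℝ} {π : Ω → ℝ} {t : ℕ} {c : ℝ}
    (h : ∀ x (A : Finset Ω), |∑ y ∈ A, (P ^ t) x y - ∑ y ∈ A, π y| ≤ c) : worstTV P π t ≤ c :=
  ciSup_le fun x => tvDist_le (h x)

theorem worstTV_nonneg [Nonempty Ω] (P : Matrix Ω Ω ℝ) (π : Ω → ℝ) (t : ℕ) :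
    0 ≤ worstTV P π t :=
  (abs_nonneg _).trans (le_worstTV P π t (Classical.arbitrary Ω) ∅)

theorem worstTV_le_one [Nonempty Ω] {P : Matrix Ω Ω ℝ} (hP : P ∈ Matrix.rowStochastic ℝ Ω)
    {π : Ω → ℝ} (hπ : ∀ x, 0 ≤ π x) (hπ1 : ∑ x, π x = 1) (t : ℕ) : worstTV P π t ≤ 1 := by
  have hPt := pow_mem hP t
  refine worstTV_le fun x A => ?_
  have hnn : ∀ y, 0 ≤ (P ^ t) x y := fun y => Matrix.nonneg_of_mem_rowStochastic hPt
  have h1 : ∑ y ∈ A, (P ^ t) x y ≤ 1 := by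
    rw [← Matrix.sum_row_of_mem_rowStochastic hPt x]
    exact Finset.sum_le_sum_of_subset_of_nonneg (Finset.subset_univ _) fun y _ _ => hnn y
  have h2 : ∑ y ∈ A, π y ≤ 1 := by
    rw [← hπ1]
    exact Finset.sum_le_sum_of_subset_of_nonneg (Finset.subset_univ _) fun y _ _ => hπ y
  have h3 : 0 ≤ ∑ y ∈ A, (P ^ t) x y := Finset.sum_nonneg fun y _ => hnn y
  have h4 : 0 ≤ ∑ y ∈ A, π y := Finset.sum_nonneg fun y _ => hπ y
  rw [abs_le]
  constructor <;> linarith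

/-- The distance to any fixed distribution does not increase in time: `P ^ (t + 1) x` is a convex
combination of the rows of `P ^ t`. -/
theorem worstTV_antitone [Nonempty Ω] {P : Matrix Ω Ω ℝ} (hP : P ∈ Matrix.rowStochastic ℝ Ω)
    (π : Ω → ℝ) : Antitone (worstTV P π) := by
  refine antitone_nat_of_succ_le fun t => worstTV_le fun x A => ?_
  have hsum : ∑ z, P x z = 1 := Matrix.sum_row_of_mem_rowStochastic hP x
  have : ∑ y ∈ A, (P ^ (t + 1)) x y - ∑ y ∈ A, π y
      = ∑ z, P x z * (∑ y ∈ A, (P ^ t) z y - ∑ y ∈ A, π y) := by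
    simp_rw [mul_sub, Finset.sum_sub_distrib, ← Finset.sum_mul, hsum, one_mul, pow_succ',
      Matrix.mul_apply, Finset.mul_sum]
    rw [Finset.sum_comm]
  rw [this]
  refine (Finset.abs_sum_le_sum_abs _ _).trans ?_
  calc ∑ z, |P x z * (∑ y ∈ A, (P ^ t) z y - ∑ y ∈ A, π y)|
      ≤ ∑ z, P x z * worstTV P π t := by
        refine Finset.sum_le_sum fun z _ => ?_
        have h0 : 0 ≤ P x z := Matrix.nonneg_of_mem_rowStochastic hP
        rw [abs_mul, abs_of_nonneg h0]
        exact mul_le_mul_of_nonneg_left (le_worstTV P π t z A) h0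
    _ = worstTV P π t := by rw [← Finset.sum_mul, hsum, one_mul]

theorem mixTime_le {P : Matrix Ω Ω ℝ} {π : Ω → ℝ} {ε : ℝ} {t : ℕ} (h : worstTV P π t < ε) :
    mixTime P π ε ≤ t :=
  Nat.sInf_le h

/-- The existence of a time `s` with `d(s) < ε` is needed because `sInf ∅ = 0`. -/
theorem lt_mixTime [Nonempty Ω] {P : Matrix Ω Ω ℝ} (hP : P ∈ Matrix.rowStochastic ℝ Ω)
    {π : Ω → ℝ} {ε : ℝ} {s t : ℕ} (hs : worstTV P π s < ε) (h : ε ≤ worstTV P π t) :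
    t < mixTime P π ε := by
  by_contra! hle
  have hmem : mixTime P π ε ∈ {t : ℕ | worstTV P π t < ε} := Nat.sInf_mem ⟨s, hs⟩
  have := worstTV_antitone hP π hle
  exact absurd (hmem.trans_le h) (not_lt.2 this)

/-! ### Symmetric chains with constant return probabilities -/

variable {P : Matrix Ω Ω ℝ}

/-- For a symmetric chain whose `2t`-step return probability does not depend on the state, the
squared `ℓ²` distance of `P ^ t x` to the uniform distribution is read off from a trace. -/
theorem card_mul_sum_sq_sub_uniform [Nonempty Ω] (hP : P ∈ Matrix.rowStochastic ℝ Ω)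
    (hsymm : P.IsSymm) {t : ℕ} (hdiag : ∀ x y, (P ^ (2 * t)) x x = (P ^ (2 * t)) y y) (x : Ω) :
    (Fintype.card Ω : ℝ) * ∑ y, ((P ^ t) x y - uniformDist Ω y) ^ 2
      = (P ^ (2 * t)).trace - 1 := by
  have hM : (Fintype.card Ω : ℝ) ≠ 0 := by simp
  have htr : (P ^ (2 * t)).trace = Fintype.card Ω * (P ^ (2 * t)) x x := by
    simp [Matrix.trace, fun y => hdiag y x]
  have hsq : (P ^ (2 * t)) x x = ∑ y, (P ^ t) x y ^ 2 := by
    rw [two_mul, pow_add, Matrix.mul_apply]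
    refine Finset.sum_congr rfl fun y _ => ?_
    rw [(hsymm.pow t).apply x y, sq]
  have hrow := Matrix.sum_row_of_mem_rowStochastic (pow_mem hP t) x
  rw [htr, hsq]
  simp_rw [sub_sq, uniformDist, Finset.sum_add_distrib, Finset.sum_sub_distrib, ← Finset.sum_mul,
    ← Finset.mul_sum, hrow]
  simp
  field_simp
  ring

theorem worstTV_sq_le_trace [Nonempty Ω] (hP : P ∈ Matrix.rowStochastic ℝ Ω)
    (hsymm : P.IsSymm) {t : ℕ} (hdiag : ∀ x y, (P ^ (2 * t)) x x = (P ^ (2 * t)) y y) :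
    worstTV P (uniformDist Ω) t ^ 2 ≤ (P ^ (2 * t)).trace - 1 := by
  have h0 : 0 ≤ (P ^ (2 * t)).trace - 1 := by
    rw [← card_mul_sum_sq_sub_uniform hP hsymm hdiag (Classical.arbitrary Ω)]
    positivity
  refine (Real.le_sqrt (worstTV_nonneg _ _ _) h0).1 (worstTV_le fun x A => Real.abs_le_sqrt ?_)
  rw [← card_mul_sum_sq_sub_uniform hP hsymm hdiag x, ← Finset.sum_sub_distrib]
  refine sq_sum_le_card_mul_sum_sq.trans ?_
  have h1 : (A.card : ℝ) ≤ Fintype.card Ω := by exact_mod_cast A.card_le_univ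
  gcongr
  exact Finset.subset_univ _

theorem tendsto_pow_of_trace [Nonempty Ω] (hP : P ∈ Matrix.rowStochastic ℝ Ω)
    (hsymm : P.IsSymm) (hdiag : ∀ t x y, (P ^ (2 * t)) x x = (P ^ (2 * t)) y y)
    (htr : Tendsto (fun t => (P ^ (2 * t)).trace) atTop (𝓝 1)) (x y : Ω) :
    Tendsto (fun t => (P ^ t) x y) atTop (𝓝 (uniformDist Ω y)) := by
  have hlim : Tendsto (fun t => √((P ^ (2 * t)).trace - 1)) atTop (𝓝 0) := by
    simpa using (htr.sub_const 1).sqrt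
  rw [tendsto_iff_dist_tendsto_zero]
  refine squeeze_zero (fun _ => dist_nonneg) (fun t => ?_) hlim
  rw [Real.dist_eq]
  refine Real.abs_le_sqrt ?_
  rw [← card_mul_sum_sq_sub_uniform hP hsymm (hdiag t) x]
  have h1 : (1 : ℝ) ≤ Fintype.card Ω := by exact_mod_cast Fintype.card_pos
  have h2 : ((P ^ t) x y - uniformDist Ω y) ^ 2 ≤ ∑ y, ((P ^ t) x y - uniformDist Ω y) ^ 2 :=
    Finset.single_le_sum (f := fun y => ((P ^ t) x y - uniformDist Ω y) ^ 2)
      (fun _ _ => sq_nonneg _) (Finset.mem_univ y)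
  exact h2.trans (le_mul_of_one_le_left (Finset.sum_nonneg fun _ _ => sq_nonneg _) h1)

/-- Convergence to the uniform distribution makes all entries of a large power positive, hence
irreducibility, and aperiodicity because consecutive times occur as return times. -/
theorem isErgodicChain_of_tendsto [Nonempty Ω] (hP : P ∈ Matrix.rowStochastic ℝ Ω)
    (h : ∀ x y, Tendsto (fun t => (P ^ t) x y) atTop (𝓝 (uniformDist Ω y))) :
    IsErgodicChain P := by
  have hpos : ∀ x y, ∀ᶠ t in atTop, 0 < (P ^ t) x y := fun x y =>
    (h x y).eventually_const_lt (by unfold uniformDist; positivity)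
  refine ⟨hP, fun x y => (hpos x y).exists, fun x d hd => ?_⟩
  obtain ⟨T, hT⟩ := eventually_atTop.1 (hpos x x)
  have h1 := hd (T + 1) (by omega) (hT _ (by omega))
  have h2 := hd (T + 2) (by omega) (hT _ (by omega))
  exact Nat.dvd_one.1 ((Nat.dvd_add_right h1).1 h2)

theorem isStationaryDist_iff_of_tendsto [Nonempty Ω] (hP : P ∈ Matrix.rowStochastic ℝ Ω)
    (hsymm : P.IsSymm)
    (h : ∀ x y, Tendsto (fun t => (P ^ t) x y) atTop (𝓝 (uniformDist Ω y))) (μ : Ω → ℝ) :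
    IsStationaryDist P μ ↔ μ = uniformDist Ω := by
  constructor
  · intro hμ
    have hpow : ∀ t, Matrix.vecMul μ (P ^ t) = μ := by
      intro t
      induction t with
      | zero => simp
      | succ t ih => rw [pow_succ, ← Matrix.vecMul_vecMul, ih, hμ.stationary]
    funext y
    have hlim : Tendsto (fun t => ∑ x, μ x * (P ^ t) x y) atTop
        (𝓝 (∑ x, μ x * uniformDist Ω y)) :=
      tendsto_finsetSum _ fun x _ => (h x y).const_mul _
    have hconst : ∀ t, ∑ x, μ x * (P ^ t) x y = μ y := fun t => congrFun (hpow t) y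
    simp_rw [hconst, ← Finset.sum_mul, hμ.sum_eq_one, one_mul] at hlim
    exact tendsto_nhds_unique tendsto_const_nhds hlim
  · rintro rfl
    refine ⟨uniformDist_nonneg, sum_uniformDist, ?_⟩
    funext y
    have hcol : ∑ x, P x y = 1 := by
      rw [← Matrix.sum_row_of_mem_rowStochastic hP y]
      exact Finset.sum_congr rfl fun x _ => hsymm.apply y x
    simp [Matrix.vecMul, dotProduct, uniformDist, ← Finset.mul_sum, hcol]

/-- The trace of a power of a symmetric matrix is the power sum of its eigenvalues. -/
theorem trace_pow_eq_sum_eigenvalues (hH : P.IsHermitian) (m : ℕ) :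
    (P ^ m).trace = ∑ j, hH.eigenvalues j ^ m := by
  conv_lhs => rw [hH.spectral_theorem, ← map_pow, Matrix.diagonal_pow,
    Unitary.conjStarAlgAut_apply, Matrix.trace_mul_cycle, Unitary.coe_star_mul_self, one_mul,
    Matrix.trace_diagonal]
  simp

/-- The multiplicity of the eigenvalue `c` of a symmetric matrix is at most the dimension of any
space into which the eigenspace of `c` embeds. -/
theorem card_eigenvalues_le_of_injOn (hH : P.IsHermitian) {ι : Type*} [Fintype ι] (c : ℝ)
    (L : (Ω → ℝ) →ₗ[ℝ] (ι → ℝ)) (hL : ∀ v, P.mulVec v = c • v → L v = 0 → v = 0) :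
    (Finset.univ.filter fun j => hH.eigenvalues j = c).card ≤ Fintype.card ι := by
  let E : Submodule ℝ (Ω → ℝ) := LinearMap.ker (P.mulVecLin - c • LinearMap.id)
  have hE : ∀ v, v ∈ E ↔ P.mulVec v = c • v := fun v => by simp [E, sub_eq_zero]
  let b : {j // hH.eigenvalues j = c} → Ω → ℝ := fun j => ⇑(hH.eigenvectorBasis j.1)
  have hb : LinearIndependent ℝ b := by
    have h0 := hH.eigenvectorBasis.toBasis.linearIndependent.comp
      (Subtype.val : {j // hH.eigenvalues j = c} → Ω) Subtype.val_injective
    have h1 := h0.map' (WithLp.linearEquiv 2 ℝ (Ω → ℝ)).toLinearMap (LinearEquiv.ker _)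
    simpa [b, Function.comp_def] using! h1
  have hspan : Submodule.span ℝ (Set.range b) ≤ E := by
    rw [Submodule.span_le]
    rintro _ ⟨j, rfl⟩
    rw [SetLike.mem_coe, hE, hH.mulVec_eigenvectorBasis, j.2]
  have hLb : LinearIndependent ℝ (L ∘ b) := by
    refine hb.map ?_
    rw [Submodule.disjoint_def]
    exact fun v hv hv0 => hL v ((hE v).1 (hspan hv)) hv0
  have := hLb.fintype_card_le_finrank
  rwa [Module.finrank_fintype_fun_eq_card, Fintype.card_subtype] at this

end FiniteChain

/-! ### The walk on the Kneser graph and indicators of supersets -/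

section Kneser

variable {n k : ℕ}

/-- The function `B ↦ 1[S ⊆ B]` on the vertices of the Kneser graph. -/
noncomputable def supersetInd (n k : ℕ) (S : Finset (Fin (2 * n + k))) : KneserVertex n k → ℝ :=
  fun B => if S ⊆ B.1 then 1 else 0

/-- The probability that a uniform `n`-subset of an `(n + k)`-set contains a fixed `i`-subset.
The eigenvalues of the walk on `K(2n + k, n)` are `(-1) ^ i * kneserEv n k i`, `i ≤ n`. -/
noncomputable def kneserEv (n k i : ℕ) : ℝ := (n.choose i : ℝ) / ((n + k).choose i : ℝ)

theorem kneserEv_zero : kneserEv n k 0 = 1 := by simp [kneserEv]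

theorem kneserEv_one : kneserEv n k 1 = (n : ℝ) / (n + k) := by simp [kneserEv]

theorem kneserEv_pos {i : ℕ} (hi : i ≤ n) : 0 < kneserEv n k i :=
  div_pos (by exact_mod_cast Nat.choose_pos hi)
    (by exact_mod_cast Nat.choose_pos (hi.trans (Nat.le_add_right n k)))

theorem kneserEv_nonneg (i : ℕ) : 0 ≤ kneserEv n k i := by unfold kneserEv; positivity

theorem kneserEv_succ {i : ℕ} (hi : i ≤ n) (hk : 1 ≤ k) :
    kneserEv n k (i + 1) = kneserEv n k i * (((n : ℝ) - i) / ((n : ℝ) + k - i)) := by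
  have h1 : (n.choose (i + 1) : ℝ) * (i + 1) = n.choose i * ((n : ℝ) - i) := by
    rw [← Nat.cast_sub hi]; exact_mod_cast Nat.choose_succ_right_eq n i
  have h2 : ((n + k).choose (i + 1) : ℝ) * (i + 1) = (n + k).choose i * ((n : ℝ) + k - i) := by
    rw [← Nat.cast_add, ← Nat.cast_sub (hi.trans (Nat.le_add_right n k))]
    exact_mod_cast Nat.choose_succ_right_eq (n + k) i
  have hi' : (i : ℝ) ≤ n := by exact_mod_cast hi
  have hk' : (1 : ℝ) ≤ k := by exact_mod_cast hk
  have h3 : (0 : ℝ) < (n + k).choose i := by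
    exact_mod_cast Nat.choose_pos (hi.trans (Nat.le_add_right n k))
  have h4 : (0 : ℝ) < (n + k).choose (i + 1) := by
    exact_mod_cast Nat.choose_pos (show i + 1 ≤ n + k by omega)
  have h5 : (0 : ℝ) < (n : ℝ) + k - i := by linarith
  have h6 : (0 : ℝ) < (i : ℝ) + 1 := by positivity
  unfold kneserEv
  rw [div_mul_div_comm, div_eq_div_iff h4.ne' (by positivity)]
  refine mul_right_cancel₀ h6.ne' ?_
  linear_combination ((n + k).choose i * ((n : ℝ) + k - i)) * h1
    - (n.choose i * ((n : ℝ) - i)) * h2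

theorem kneserEv_succ_le {i : ℕ} (hi : i ≤ n) (hk : 1 ≤ k) :
    kneserEv n k (i + 1) ≤ kneserEv n k i * kneserEv n k 1 := by
  have hi' : (i : ℝ) ≤ n := by exact_mod_cast hi
  have hk' : (1 : ℝ) ≤ k := by exact_mod_cast hk
  rw [kneserEv_succ hi hk, kneserEv_one]
  refine mul_le_mul_of_nonneg_left ?_ (kneserEv_nonneg i)
  rw [div_le_div_iff₀ (by linarith) (by linarith [Nat.cast_nonneg (α := ℝ) n])]
  nlinarith [mul_nonneg (Nat.cast_nonneg (α := ℝ) i) (Nat.cast_nonneg (α := ℝ) k)]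

theorem kneserEv_le_pow {i : ℕ} (hi : i ≤ n) (hk : 1 ≤ k) :
    kneserEv n k i ≤ kneserEv n k 1 ^ i := by
  induction i with
  | zero => simp [kneserEv_zero]
  | succ i ih =>
    rw [pow_succ]
    exact (kneserEv_succ_le (by omega) hk).trans
      (mul_le_mul_of_nonneg_right (ih (by omega)) (kneserEv_nonneg 1))

theorem kneserEv_one_lt_one (hk : 1 ≤ k) : kneserEv n k 1 < 1 := by
  have hk' : (1 : ℝ) ≤ k := by exact_mod_cast hk
  rw [kneserEv_one, div_lt_one (by linarith [Nat.cast_nonneg (α := ℝ) n])]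
  linarith

theorem kneserEv_strictAnti (hk : 1 ≤ k) {i j : ℕ} (hij : i < j) (hj : j ≤ n) :
    kneserEv n k j < kneserEv n k i := by
  induction j, hij using Nat.le_induction with
  | base =>
    exact (kneserEv_succ_le (by omega) hk).trans_lt
      (mul_lt_of_lt_one_right (kneserEv_pos (by omega)) (kneserEv_one_lt_one hk))
  | succ j _ ih =>
    exact ((kneserEv_succ_le (by omega) hk).trans_lt
      (mul_lt_of_lt_one_right (kneserEv_pos (by omega)) (kneserEv_one_lt_one hk))).trans
      (ih (by omega))

theorem signed_kneserEv_injOn (hk : 1 ≤ k) {i j : ℕ} (hi : i ≤ n) (hj : j ≤ n)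
    (h : (-1) ^ i * kneserEv n k i = (-1) ^ j * kneserEv n k j) : i = j := by
  have habs : ∀ l, |(-1) ^ l * kneserEv n k l| = kneserEv n k l := fun l => by
    rw [abs_mul, abs_pow, abs_neg, abs_one, one_pow, one_mul, abs_of_nonneg (kneserEv_nonneg l)]
  have h' : kneserEv n k i = kneserEv n k j := by rw [← habs i, h, habs j]
  rcases lt_trichotomy i j with hlt | heq | hgt
  · exact absurd h' (kneserEv_strictAnti hk hlt hj).ne'
  · exact heq
  · exact absurd h' (kneserEv_strictAnti hk hgt hi).ne

instance kneserVertex_nonempty (n k : ℕ) : Nonempty (KneserVertex n k) := by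
  obtain ⟨A, -, hA⟩ := Finset.exists_subset_card_eq
    (s := (Finset.univ : Finset (Fin (2 * n + k)))) (n := n) (by simp; omega)
  exact ⟨⟨A, hA⟩⟩

theorem kneserGraph_adj (hn : 1 ≤ n) {A B : KneserVertex n k} :
    (kneserGraph n k).Adj A B ↔ Disjoint A.1 B.1 := by
  refine ⟨fun h => h.2, fun h => ⟨?_, h⟩⟩
  rintro rfl
  have := A.2
  rw [disjoint_self.1 h] at this
  simp at this
  omega

theorem card_compl_vertex (A : KneserVertex n k) : (A.1ᶜ).card = n + k := by
  rw [Finset.card_compl, A.2, Fintype.card_fin]; omega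

theorem card_disjoint_superset (A : KneserVertex n k) (S : Finset (Fin (2 * n + k))) :
    (Finset.univ.filter fun B : KneserVertex n k => Disjoint A.1 B.1 ∧ S ⊆ B.1).card
      = (((A.1ᶜ).powersetCard n).filter (S ⊆ ·)).card := by
  refine Finset.card_bij (fun B _ => B.1) ?_ ?_ ?_
  · intro B hB
    simp only [Finset.mem_filter, Finset.mem_univ, true_and, Finset.mem_powersetCard] at hB ⊢
    exact ⟨⟨Finset.subset_compl_iff_disjoint_left.2 hB.1, B.2⟩, hB.2⟩
  · intro B _ B' _ h
    exact Subtype.ext h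
  · intro B hB
    simp only [Finset.mem_filter, Finset.mem_powersetCard] at hB
    exact ⟨⟨B, hB.1.2⟩, by simpa using
      ⟨Finset.subset_compl_iff_disjoint_left.1 hB.1.1, hB.2⟩, rfl⟩

theorem card_disjoint_superset_eq (A : KneserVertex n k) (S : Finset (Fin (2 * n + k))) :
    ((Finset.univ.filter fun B : KneserVertex n k => Disjoint A.1 B.1 ∧ S ⊆ B.1).card : ℝ)
      = if Disjoint S A.1 then kneserEv n k S.card * (n + k).choose n else 0 := by
  rw [card_disjoint_superset]
  split_ifs with h
  · have hS : S ⊆ A.1ᶜ := Finset.subset_compl_iff_disjoint_right.2 h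
    rcases le_or_gt S.card n with hSn | hSn
    · rw [Finset.card_filter_powersetCard_subset _ _ _ hS hSn, card_compl_vertex]
      have h1 := Nat.choose_mul (n := n + k) (k := n) (s := S.card) hSn
      have h2 : (0 : ℝ) < (n + k).choose S.card := by
        exact_mod_cast Nat.choose_pos (show S.card ≤ n + k by omega)
      have h3 : ((n + k).choose n : ℝ) * n.choose S.card
        = (n + k).choose S.card * (n + k - S.card).choose (n - S.card) := by exact_mod_cast h1
      rw [kneserEv]
      field_simp
      linarith
    · rw [kneserEv, Nat.choose_eq_zero_of_lt hSn, Nat.cast_zero, zero_div, zero_mul,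
        Nat.cast_eq_zero, Finset.card_eq_zero, Finset.filter_eq_empty_iff]
      intro B hB hSB
      have := Finset.card_le_card hSB
      rw [(Finset.mem_powersetCard.1 hB).2] at this
      omega
  · rw [Nat.cast_eq_zero, Finset.card_eq_zero, Finset.filter_eq_empty_iff]
    intro B hB hSB
    exact h (Finset.subset_compl_iff_disjoint_right.1
      (hSB.trans (Finset.mem_powersetCard.1 hB).1))

theorem kneserGraph_degree (hn : 1 ≤ n) (A : KneserVertex n k) :
    ((kneserGraph n k).degree A : ℝ) = (n + k).choose n := by
  have h := card_disjoint_superset_eq A ∅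
  simp only [Finset.empty_subset, and_true, Finset.disjoint_empty_left, if_true,
    Finset.card_empty, kneserEv_zero, one_mul] at h
  rw [← h, ← SimpleGraph.card_neighborFinset_eq_degree]
  congr 2
  ext B
  simp [kneserGraph_adj hn]

theorem kneserWalk_apply (hn : 1 ≤ n) (A B : KneserVertex n k) :
    kneserWalk n k A B = if Disjoint A.1 B.1 then 1 / ((n + k).choose n : ℝ) else 0 := by
  simp only [kneserWalk, srwMatrix, kneserGraph_adj hn, kneserGraph_degree hn]

theorem kneserWalk_isSymm (hn : 1 ≤ n) : (kneserWalk n k).IsSymm := by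
  ext A B
  simp only [Matrix.transpose_apply, kneserWalk_apply hn, disjoint_comm]

/-- One step of the walk from `A` covers `S` with probability `kneserEv n k S.card` if `S` avoids
`A`, and with probability zero otherwise. -/
theorem kneserWalk_mulVec_supersetInd (hn : 1 ≤ n) (S : Finset (Fin (2 * n + k)))
    (A : KneserVertex n k) :
    ((kneserWalk n k).mulVec (supersetInd n k S)) A
      = if Disjoint S A.1 then kneserEv n k S.card else 0 := by
  have h := card_disjoint_superset_eq A S
  have h0 : (0 : ℝ) < (n + k).choose n := by
    exact_mod_cast Nat.choose_pos (Nat.le_add_right n k)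
  have h1 : ((kneserWalk n k).mulVec (supersetInd n k S)) A
      = 1 / ((n + k).choose n : ℝ)
        * (Finset.univ.filter fun B : KneserVertex n k => Disjoint A.1 B.1 ∧ S ⊆ B.1).card := by
    rw [Finset.card_filter]
    push_cast
    rw [Finset.mul_sum, Matrix.mulVec, dotProduct]
    refine Finset.sum_congr rfl fun B _ => ?_
    rw [kneserWalk_apply hn, supersetInd]
    by_cases hA : Disjoint A.1 B.1 <;> simp [hA]
  rw [h1, h]
  split_ifs
  · field_simp
  · simp

theorem kneserWalk_mem_rowStochastic (hn : 1 ≤ n) :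
    kneserWalk n k ∈ Matrix.rowStochastic ℝ (KneserVertex n k) := by
  rw [Matrix.mem_rowStochastic_iff_sum]
  constructor
  · intro A B
    rw [kneserWalk_apply hn]
    split_ifs <;> positivity
  · intro A
    have := kneserWalk_mulVec_supersetInd (k := k) hn ∅ A
    simpa [Matrix.mulVec, dotProduct, supersetInd, kneserEv_zero] using this

/-! ### Multiplicities of the eigenvalues -/

/-- Inclusion–exclusion for the event that `S` avoids `A`. -/
theorem sum_powerset_neg_one_pow_supersetInd (S : Finset (Fin (2 * n + k)))
    (A : KneserVertex n k) :
    ∑ T ∈ S.powerset, (-1) ^ T.card * supersetInd n k T A = if Disjoint S A.1 then 1 else 0 := by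
  have h1 : ∑ T ∈ S.powerset, (-1) ^ T.card * supersetInd n k T A
      = ∑ T ∈ (S ∩ A.1).powerset, ((-1 : ℝ)) ^ T.card := by
    have : (S ∩ A.1).powerset = S.powerset.filter (· ⊆ A.1) := by
      ext T; rw [Finset.mem_powerset, Finset.subset_inter_iff, Finset.mem_filter,
        Finset.mem_powerset]
    rw [this, Finset.sum_filter]
    refine Finset.sum_congr rfl fun T _ => ?_
    simp [supersetInd]
  have h2 := Finset.sum_powerset_neg_one_pow_card (x := S ∩ A.1)
  simp only [h1, Finset.disjoint_iff_inter_eq_empty]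
  exact_mod_cast congrArg (Int.cast : ℤ → ℝ) h2

/-- Pairing an eigenvector `v` with the functions `supersetInd n k S` turns the eigenvalue equation
into a triangular recursion over subsets of `S`. -/
theorem smul_dotProduct_supersetInd (hn : 1 ≤ n) {v : KneserVertex n k → ℝ} {c : ℝ}
    (hv : (kneserWalk n k).mulVec v = c • v) (S : Finset (Fin (2 * n + k))) :
    c * (v ⬝ᵥ supersetInd n k S)
      = kneserEv n k S.card * ∑ T ∈ S.powerset, (-1) ^ T.card * (v ⬝ᵥ supersetInd n k T) := by
  have h1 : c * (v ⬝ᵥ supersetInd n k S)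
      = v ⬝ᵥ ((kneserWalk n k).mulVec (supersetInd n k S)) := by
    rw [← smul_eq_mul, ← smul_dotProduct, ← hv, Matrix.dotProduct_mulVec,
      ← Matrix.mulVec_transpose, (kneserWalk_isSymm hn).eq]
  have h2 : (kneserWalk n k).mulVec (supersetInd n k S)
      = kneserEv n k S.card • ∑ T ∈ S.powerset, (-1 : ℝ) ^ T.card • supersetInd n k T := by
    funext A
    rw [kneserWalk_mulVec_supersetInd hn, Pi.smul_apply, Finset.sum_apply]
    simp only [Pi.smul_apply, smul_eq_mul]
    rw [sum_powerset_neg_one_pow_supersetInd]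
    simp
  rw [h1, h2, dotProduct_smul, dotProduct_sum]
  simp only [dotProduct_smul, smul_eq_mul]

/-- An eigenvector with eigenvalue `c` vanishes once it is orthogonal to `supersetInd n k S` for
all `S` whose size `i` satisfies `c = (-1) ^ i * kneserEv n k i`: the diagonal coefficient of the
triangular recursion is nonzero for all other sizes. -/
theorem eigenvector_eq_zero (hn : 1 ≤ n) {v : KneserVertex n k → ℝ} {c : ℝ}
    (hv : (kneserWalk n k).mulVec v = c • v)
    (h : ∀ S : Finset (Fin (2 * n + k)), S.card ≤ n →
      c = (-1) ^ S.card * kneserEv n k S.card → v ⬝ᵥ supersetInd n k S = 0) : v = 0 := by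
  have key : ∀ S : Finset (Fin (2 * n + k)), S.card ≤ n → v ⬝ᵥ supersetInd n k S = 0 := by
    intro S
    induction S using Finset.strongInduction with
    | H S ih =>
      intro hS
      by_cases hc : c = (-1) ^ S.card * kneserEv n k S.card
      · exact h S hS hc
      · have hrec := smul_dotProduct_supersetInd hn hv S
        rw [Finset.sum_eq_single_of_mem S (Finset.mem_powerset_self S)] at hrec
        · have : (c - (-1) ^ S.card * kneserEv n k S.card) * (v ⬝ᵥ supersetInd n k S) = 0 := by
            linear_combination hrec
          exact (mul_eq_zero.1 this).resolve_left (sub_ne_zero.2 hc)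
        · intro T hT hne
          have hTS := (Finset.mem_powerset.1 hT).ssubset_of_ne hne
          rw [ih T hTS ((Finset.card_lt_card hTS).le.trans hS), mul_zero]
  funext B
  have hB := key B.1 B.2.le
  have hind : supersetInd n k B.1 = Pi.single B 1 := by
    funext A
    have hiff : B.1 ⊆ A.1 ↔ A = B := by
      refine ⟨fun hsub => ?_, fun e => e ▸ subset_rfl⟩
      exact (Subtype.ext (Finset.eq_of_subset_of_card_le hsub (by rw [A.2, B.2]))).symm
    simp only [supersetInd, hiff, Pi.single_apply]
  rw [hind, dotProduct_single_one] at hB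
  exact hB

theorem kneserWalk_isHermitian (hn : 1 ≤ n) : (kneserWalk n k).IsHermitian := by
  rw [Matrix.IsHermitian, Matrix.conjTranspose_eq_transpose_of_trivial]
  exact kneserWalk_isSymm hn

theorem exists_eigenvalue_eq (hn : 1 ≤ n) (j : KneserVertex n k) :
    ∃ i ∈ Finset.range (n + 1),
      (kneserWalk_isHermitian hn).eigenvalues j = (-1) ^ i * kneserEv n k i := by
  by_contra! hne
  have h0 := eigenvector_eq_zero hn ((kneserWalk_isHermitian hn).mulVec_eigenvectorBasis j)
    fun S hS hc => absurd hc (hne S.card (Finset.mem_range.2 (by omega)))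
  refine (kneserWalk_isHermitian hn).eigenvectorBasis.toBasis.ne_zero j ?_
  ext x
  simpa using congrFun h0 x

theorem card_eigenvalues_le (hn : 1 ≤ n) (hk : 1 ≤ k) {i : ℕ} (hi : i ≤ n) :
    (Finset.univ.filter fun j =>
      (kneserWalk_isHermitian (k := k) hn).eigenvalues j = (-1) ^ i * kneserEv n k i).card
      ≤ (2 * n + k).choose i := by
  let L : (KneserVertex n k → ℝ) →ₗ[ℝ]
      ({S // S ∈ (Finset.univ : Finset (Fin (2 * n + k))).powersetCard i} → ℝ) :=
    { toFun := fun v S => v ⬝ᵥ supersetInd n k S.1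
      map_add' := fun v w => funext fun S => add_dotProduct _ _ _
      map_smul' := fun c v => funext fun S => smul_dotProduct _ _ _ }
  have h := card_eigenvalues_le_of_injOn (kneserWalk_isHermitian (k := k) hn)
    ((-1) ^ i * kneserEv n k i) L fun v hv hL => eigenvector_eq_zero hn hv fun S hS hc => by
      have hcard : S.card = i := (signed_kneserEv_injOn hk hi hS hc).symm
      exact congrFun hL ⟨S, Finset.mem_powersetCard.2 ⟨Finset.subset_univ _, hcard⟩⟩
  simpa using h

theorem trace_kneserWalk_pow_le (hn : 1 ≤ n) (hk : 1 ≤ k) (t : ℕ) :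
    ((kneserWalk n k) ^ (2 * t)).trace ≤ (1 + kneserEv n k 1 ^ (2 * t)) ^ (2 * n + k) := by
  set q := kneserEv n k 1 ^ (2 * t) with hq
  have hq0 : 0 ≤ q := pow_nonneg (kneserEv_nonneg 1) _
  have hH := kneserWalk_isHermitian (k := k) hn
  rw [trace_pow_eq_sum_eigenvalues hH]
  calc ∑ j, hH.eigenvalues j ^ (2 * t)
      ≤ ∑ j, ∑ i ∈ Finset.range (n + 1),
          if hH.eigenvalues j = (-1) ^ i * kneserEv n k i then q ^ i else 0 := by
        refine Finset.sum_le_sum fun j _ => ?_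
        obtain ⟨i, hi, hij⟩ := exists_eigenvalue_eq hn j
        refine le_trans ?_ (Finset.single_le_sum (fun i _ => ?_) hi)
        · have hsign : ((-1 : ℝ) ^ i) ^ (2 * t) = 1 := by
            rw [← pow_mul]
            exact Even.neg_one_pow ⟨i * t, by ring⟩
          rw [if_pos hij, hij, mul_pow, hsign, one_mul, hq, ← pow_mul, mul_comm (2 * t) i,
            pow_mul _ i]
          exact pow_le_pow_left₀ (kneserEv_nonneg i)
            (kneserEv_le_pow (by simpa [Nat.lt_succ_iff] using hi) hk) _
        · split_ifs <;> positivity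
    _ = ∑ i ∈ Finset.range (n + 1), q ^ i * (Finset.univ.filter fun j =>
          hH.eigenvalues j = (-1) ^ i * kneserEv n k i).card := by
        rw [Finset.sum_comm]
        refine Finset.sum_congr rfl fun i _ => ?_
        rw [← Finset.sum_filter, Finset.sum_const, nsmul_eq_mul, mul_comm]
    _ ≤ ∑ i ∈ Finset.range (n + 1), q ^ i * (2 * n + k).choose i := by
        refine Finset.sum_le_sum fun i hi => ?_
        have hi' : i ≤ n := by simpa [Nat.lt_succ_iff] using hi
        exact mul_le_mul_of_nonneg_left (by exact_mod_cast card_eigenvalues_le hn hk hi')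
          (by positivity)
    _ ≤ ∑ i ∈ Finset.range (2 * n + k + 1), q ^ i * (2 * n + k).choose i :=
        Finset.sum_le_sum_of_subset_of_nonneg
          (Finset.range_subset_range.2 (by omega)) fun i _ _ => by positivity
    _ = (1 + q) ^ (2 * n + k) := by
        rw [add_comm 1 q, add_pow]
        simp

/-! ### Convergence to equilibrium -/

/-- Permutations of the ground set act transitively on the vertices by automorphisms. -/
theorem kneserWalk_pow_diag (hn : 1 ≤ n) (m : ℕ) (A B : KneserVertex n k) :
    ((kneserWalk n k) ^ m) A A = ((kneserWalk n k) ^ m) B B := by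
  obtain ⟨e⟩ : Nonempty ({x // x ∈ A.1} ≃ {x // x ∈ B.1}) :=
    ⟨Fintype.equivOfCardEq (by simp [A.2, B.2])⟩
  let σ : Equiv.Perm (Fin (2 * n + k)) := e.extendSubtype
  have hσ : A.1.map σ.toEmbedding = B.1 := by
    refine Finset.eq_of_subset_of_card_le (fun x hx => ?_) (by simp [A.2, B.2])
    obtain ⟨y, hy, rfl⟩ := Finset.mem_map.1 hx
    exact e.extendSubtype_mem y hy
  let E : KneserVertex n k ≃ KneserVertex n k :=
    (Equiv.finsetCongr σ).subtypeEquiv fun S => by simp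
  have hEA : E A = B := Subtype.ext (by simpa [E] using! hσ)
  have hP : (kneserWalk n k).submatrix E E = kneserWalk n k := by
    ext C D
    rw [Matrix.submatrix_apply, kneserWalk_apply hn, kneserWalk_apply hn]
    have : Disjoint (E C).1 (E D).1 ↔ Disjoint C.1 D.1 := Finset.disjoint_map σ.toEmbedding
    simp only [this]
  have hPm : ((kneserWalk n k) ^ m).submatrix E E = (kneserWalk n k) ^ m := by
    induction m with
    | zero => simp
    | succ m ih => rw [pow_succ, ← Matrix.submatrix_mul_equiv _ _ _ E, ih, hP]
  rw [← hEA]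
  exact congrFun (congrFun hPm.symm A) A

theorem worstTV_kneserWalk_sq_le (hn : 1 ≤ n) (hk : 1 ≤ k) (t : ℕ) :
    worstTV (kneserWalk n k) (uniformDist _) t ^ 2
      ≤ Real.exp ((2 * n + k) * kneserEv n k 1 ^ (2 * t)) - 1 := by
  refine (worstTV_sq_le_trace (kneserWalk_mem_rowStochastic hn) (kneserWalk_isSymm hn)
    (kneserWalk_pow_diag hn _)).trans (sub_le_sub_right ?_ 1)
  refine (trace_kneserWalk_pow_le hn hk t).trans ?_
  have h : (1 + kneserEv n k 1 ^ (2 * t)) ^ (2 * n + k)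
      ≤ Real.exp (kneserEv n k 1 ^ (2 * t)) ^ (2 * n + k) :=
    pow_le_pow_left₀ (add_nonneg zero_le_one (pow_nonneg (kneserEv_nonneg 1) _))
      (by rw [add_comm]; exact Real.add_one_le_exp _) _
  refine h.trans_eq ?_
  rw [← Real.exp_nat_mul]
  push_cast
  rfl

theorem tendsto_kneserWalk_pow (hn : 1 ≤ n) (hk : 1 ≤ k) (A B : KneserVertex n k) :
    Tendsto (fun t => ((kneserWalk n k) ^ t) A B) atTop (𝓝 (uniformDist _ B)) := by
  refine tendsto_pow_of_trace (kneserWalk_mem_rowStochastic hn) (kneserWalk_isSymm hn)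
    (fun t => kneserWalk_pow_diag hn _) ?_ A B
  have hlim : Tendsto (fun t => (1 + kneserEv n k 1 ^ (2 * t)) ^ (2 * n + k)) atTop (𝓝 1) := by
    have h1 : Tendsto (fun t => kneserEv n k 1 ^ (2 * t)) atTop (𝓝 0) :=
      (tendsto_pow_atTop_nhds_zero_of_lt_one (kneserEv_nonneg 1) (kneserEv_one_lt_one hk)).comp
        (tendsto_id.const_mul_atTop' two_pos)
    simpa using (h1.const_add 1).pow (2 * n + k)
  refine tendsto_of_tendsto_of_tendsto_of_le_of_le tendsto_const_nhds hlim (fun t => ?_)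
    fun t => trace_kneserWalk_pow_le hn hk t
  have := (sq_nonneg _).trans (worstTV_sq_le_trace (kneserWalk_mem_rowStochastic (k := k) hn)
    (kneserWalk_isSymm hn) (kneserWalk_pow_diag hn (2 * t)))
  show (1 : ℝ) ≤ _
  linarith

end Kneser

/-! ### Second moment lower bound -/

section SecondMoment

variable {Ω : Type*} [Fintype Ω] [DecidableEq Ω] {P : Matrix Ω Ω ℝ}

theorem mulVec_mono_of_mem_rowStochastic (hP : P ∈ Matrix.rowStochastic ℝ Ω) {f g : Ω → ℝ}
    (h : f ≤ g) : P.mulVec f ≤ P.mulVec g := fun _ =>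
  Finset.sum_le_sum fun y _ =>
    mul_le_mul_of_nonneg_left (h y) (Matrix.nonneg_of_mem_rowStochastic hP)

theorem mulVec_const_of_mem_rowStochastic (hP : P ∈ Matrix.rowStochastic ℝ Ω) (a : ℝ) :
    P.mulVec (fun _ => a) = fun _ => a := by
  funext x
  simp [Matrix.mulVec, dotProduct, ← Finset.sum_mul, Matrix.sum_row_of_mem_rowStochastic hP x]

theorem pow_mulVec_of_eigenfunction {f : Ω → ℝ} {c : ℝ} (hf : P.mulVec f = c • f) (t : ℕ) :
    (P ^ t).mulVec f = c ^ t • f := by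
  induction t with
  | zero => simp
  | succ t ih => rw [pow_succ, ← Matrix.mulVec_mulVec, hf, Matrix.mulVec_smul, ih, smul_smul,
      pow_succ']

/-- The one-step second moment bound iterates. For an eigenfunction with eigenvalue `c` it says that
the variance of `f` after `t` steps is at most `V`. -/
theorem pow_mulVec_sq_le (hP : P ∈ Matrix.rowStochastic ℝ Ω) {f : Ω → ℝ} {c V : ℝ}
    (hf2 : P.mulVec (f ^ 2) ≤ fun x => c ^ 2 * f x ^ 2 + (1 - c ^ 2) * V) (t : ℕ) (x : Ω) :
    (P ^ t).mulVec (f ^ 2) x ≤ (c ^ t * f x) ^ 2 + (1 - (c ^ t) ^ 2) * V := by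
  induction t generalizing x with
  | zero => simp
  | succ t ih =>
    have hmono := mulVec_mono_of_mem_rowStochastic (pow_mem hP t) hf2 x
    have heq : (P ^ t).mulVec (fun x => c ^ 2 * f x ^ 2 + (1 - c ^ 2) * V) x
        = c ^ 2 * (P ^ t).mulVec (f ^ 2) x + (1 - c ^ 2) * V := by
      have : (fun x => c ^ 2 * f x ^ 2 + (1 - c ^ 2) * V)
          = c ^ 2 • f ^ 2 + fun _ => (1 - c ^ 2) * V := by
        funext x; simp
      rw [this, Matrix.mulVec_add, Matrix.mulVec_smul,
        mulVec_const_of_mem_rowStochastic (pow_mem hP t)]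
      rfl
    rw [pow_succ, ← Matrix.mulVec_mulVec]
    refine (hmono.trans_eq heq).trans ?_
    have := mul_le_mul_of_nonneg_left (ih x) (sq_nonneg c)
    rw [pow_succ c t]
    linarith

/-- Chebyshev's inequality separates the law at time `t` from equilibrium by the event that the
eigenfunction `f` is closer to `0`, its stationary mean, than to its mean `c ^ t * f x` at
time `t`. -/
theorem sq_mul_one_sub_worstTV_le (hP : P ∈ Matrix.rowStochastic ℝ Ω)
    {π : Ω → ℝ} (hπ : IsStationaryDist P π) {f : Ω → ℝ} {c V : ℝ} (hc : c ^ 2 < 1)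
    (hV : 0 ≤ V) (hf : P.mulVec f = c • f)
    (hf2 : P.mulVec (f ^ 2) ≤ fun x => c ^ 2 * f x ^ 2 + (1 - c ^ 2) * V) (t : ℕ) (x : Ω) :
    (c ^ t * f x) ^ 2 * (1 - worstTV P π t) ≤ 8 * V := by
  set m := c ^ t * f x with hm
  have hPt := pow_mem hP t
  have hrow := Matrix.sum_row_of_mem_rowStochastic hPt x
  have hnn : ∀ y, 0 ≤ (P ^ t) x y := fun y => Matrix.nonneg_of_mem_rowStochastic hPt
  have hvar : ∑ y, (P ^ t) x y * (f y - m) ^ 2 ≤ V := by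
    have h1 : ∑ y, (P ^ t) x y * f y = m := congrFun (pow_mulVec_of_eigenfunction hf t) x
    have h2 : ∑ y, (P ^ t) x y * f y ^ 2 ≤ m ^ 2 + (1 - (c ^ t) ^ 2) * V :=
      pow_mulVec_sq_le hP hf2 t x
    have h3 : ∑ y, (P ^ t) x y * (f y - m) ^ 2
        = ∑ y, (P ^ t) x y * f y ^ 2 - 2 * m * (∑ y, (P ^ t) x y * f y)
          + m ^ 2 * ∑ y, (P ^ t) x y := by
      rw [Finset.mul_sum, Finset.mul_sum, ← Finset.sum_sub_distrib, ← Finset.sum_add_distrib]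
      exact Finset.sum_congr rfl fun y _ => by ring
    rw [h3, h1, hrow]
    nlinarith [mul_nonneg (sq_nonneg (c ^ t)) hV]
  have hstat : ∑ y, π y * f y ^ 2 ≤ V := by
    have h1 : ∑ y, π y * P.mulVec (f ^ 2) y = ∑ y, π y * f y ^ 2 := by
      have : π ⬝ᵥ P.mulVec (f ^ 2) = π ⬝ᵥ f ^ 2 := by
        rw [Matrix.dotProduct_mulVec, hπ.stationary]
      exact this
    have h2 : ∑ y, π y * P.mulVec (f ^ 2) y
        ≤ ∑ y, π y * (c ^ 2 * f y ^ 2 + (1 - c ^ 2) * V) :=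
      Finset.sum_le_sum fun y _ => mul_le_mul_of_nonneg_left (hf2 y) (hπ.nonneg y)
    have h3 : ∑ y, π y * (c ^ 2 * f y ^ 2 + (1 - c ^ 2) * V)
        = c ^ 2 * ∑ y, π y * f y ^ 2 + (1 - c ^ 2) * V := by
      simp_rw [mul_add, Finset.sum_add_distrib, ← Finset.sum_mul, hπ.sum_eq_one, Finset.mul_sum,
        one_mul]
      congr 1
      exact Finset.sum_congr rfl fun y _ => by ring
    rw [h1, h3] at h2
    have h4 : (1 - c ^ 2) * (∑ y, π y * f y ^ 2 - V) ≤ 0 := by linarith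
    by_contra! hlt
    exact absurd h4 (not_le.2 (mul_pos (by linarith) (by linarith)))
  classical
  set A : Finset Ω := Finset.univ.filter fun y => f y ^ 2 < m ^ 2 / 4 with hA
  have hPA : m ^ 2 / 4 * ∑ y ∈ A, (P ^ t) x y ≤ V := by
    refine le_trans ?_ hvar
    rw [Finset.mul_sum]
    refine (Finset.sum_le_sum fun y hy => ?_).trans
      (Finset.sum_le_sum_of_subset_of_nonneg A.subset_univ fun y _ _ =>
        mul_nonneg (hnn y) (sq_nonneg _))
    have hy' : f y ^ 2 < m ^ 2 / 4 := (Finset.mem_filter.1 hy).2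
    have habs : |f y| < |m| / 2 := by
      rw [← abs_of_nonneg (show (0 : ℝ) ≤ |m| / 2 by positivity), ← sq_lt_sq]
      rw [div_pow, sq_abs]; linarith
    have hge : (|m| / 2) ^ 2 ≤ (f y - m) ^ 2 := by
      rw [sq_le_sq, abs_of_nonneg (show (0 : ℝ) ≤ |m| / 2 by positivity)]
      have := abs_sub_abs_le_abs_sub m (f y)
      rw [abs_sub_comm m] at this
      linarith
    rw [div_pow, sq_abs] at hge
    have := mul_le_mul_of_nonneg_left hge (hnn y)
    linarith
  have hπA : m ^ 2 / 4 * (1 - ∑ y ∈ A, π y) ≤ V := by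
    refine le_trans ?_ hstat
    have hcompl : 1 - ∑ y ∈ A, π y = ∑ y ∈ Aᶜ, π y := by
      rw [← hπ.sum_eq_one, ← Finset.sum_add_sum_compl A]; ring
    rw [hcompl, Finset.mul_sum]
    refine (Finset.sum_le_sum fun y hy => ?_).trans
      (Finset.sum_le_sum_of_subset_of_nonneg (Finset.subset_univ Aᶜ) fun y _ _ =>
        mul_nonneg (hπ.nonneg y) (sq_nonneg _))
    have hy' : m ^ 2 / 4 ≤ f y ^ 2 := by simpa [hA] using hy
    have := mul_le_mul_of_nonneg_left hy' (hπ.nonneg y)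
    linarith
  have hd := (abs_le.1 (le_worstTV P π t x A)).1
  have := mul_le_mul_of_nonneg_left hd (by positivity : (0 : ℝ) ≤ m ^ 2 / 4)
  nlinarith

end SecondMoment

section KneserLower

variable {n k : ℕ}

/-- The size of the intersection with a fixed vertex `A₀`. -/
noncomputable def overlap (A₀ : KneserVertex n k) : KneserVertex n k → ℝ :=
  fun B => ((A₀.1 ∩ B.1).card : ℝ)

theorem overlap_eq_sum (A₀ : KneserVertex n k) :
    overlap A₀ = ∑ a ∈ A₀.1, supersetInd n k {a} := by
  funext B
  rw [Finset.sum_apply]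
  simp only [supersetInd, Finset.singleton_subset_iff, overlap]
  rw [← Finset.sum_filter, Finset.sum_const, nsmul_eq_mul, mul_one, Finset.filter_mem_eq_inter]

theorem overlap_sq_eq_sum (A₀ : KneserVertex n k) :
    overlap A₀ ^ 2 = ∑ a ∈ A₀.1, ∑ b ∈ A₀.1, supersetInd n k {a, b} := by
  rw [overlap_eq_sum, sq, Finset.sum_mul_sum]
  refine Finset.sum_congr rfl fun a _ => Finset.sum_congr rfl fun b _ => ?_
  funext B
  by_cases ha : a ∈ B.1 <;> by_cases hb : b ∈ B.1 <;>
    simp [supersetInd, Finset.insert_subset_iff, ha, hb]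

theorem overlap_self (A₀ : KneserVertex n k) : overlap A₀ A₀ = n := by
  simp [overlap, A₀.2]

theorem card_sdiff_eq_sub_overlap (A₀ A : KneserVertex n k) :
    ((A₀.1 \ A.1).card : ℝ) = n - overlap A₀ A := by
  have h := Finset.card_sdiff_add_card_inter A₀.1 A.1
  rw [A₀.2] at h
  rw [overlap, eq_sub_iff_add_eq]
  exact_mod_cast h

theorem kneserWalk_mulVec_overlap (hn : 1 ≤ n) (A₀ A : KneserVertex n k) :
    (kneserWalk n k).mulVec (overlap A₀) A = kneserEv n k 1 * (n - overlap A₀ A) := by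
  rw [overlap_eq_sum, Matrix.mulVec_sum, Finset.sum_apply, ← overlap_eq_sum]
  simp_rw [kneserWalk_mulVec_supersetInd hn, Finset.disjoint_singleton_left,
    Finset.card_singleton]
  rw [← Finset.sum_filter, Finset.sum_const, nsmul_eq_mul, ← Finset.sdiff_eq_filter,
    card_sdiff_eq_sub_overlap, mul_comm]

/-- Distinct points are covered negatively correlated, so the conditional variance of the overlap
is at most that of a binomial variable. -/
theorem kneserWalk_mulVec_overlap_sq_le (hn : 1 ≤ n) (hk : 1 ≤ k) (A₀ A : KneserVertex n k) :
    (kneserWalk n k).mulVec (overlap A₀ ^ 2) A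
      ≤ (kneserEv n k 1 * (n - overlap A₀ A)) ^ 2
        + kneserEv n k 1 * (1 - kneserEv n k 1) * (n - overlap A₀ A) := by
  set q := kneserEv n k 1 with hq
  have hsum : (kneserWalk n k).mulVec (overlap A₀ ^ 2) A
      = ∑ a ∈ A₀.1 \ A.1, ∑ b ∈ A₀.1 \ A.1, kneserEv n k ({a, b} : Finset _).card := by
    rw [overlap_sq_eq_sum, Matrix.mulVec_sum, Finset.sum_apply, Finset.sdiff_eq_filter,
      Finset.sum_filter]
    refine Finset.sum_congr rfl fun a _ => ?_
    rw [Matrix.mulVec_sum, Finset.sum_apply, Finset.sum_filter]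
    simp_rw [kneserWalk_mulVec_supersetInd hn, Finset.disjoint_insert_left,
      Finset.disjoint_singleton_left]
    by_cases ha : a ∈ A.1 <;> simp [ha]
  have hterm : ∀ a b, kneserEv n k ({a, b} : Finset (Fin (2 * n + k))).card
      ≤ q ^ 2 + if a = b then q * (1 - q) else 0 := by
    intro a b
    by_cases hab : a = b
    · subst hab
      simp only [Finset.pair_eq_singleton, Finset.card_singleton, if_true]
      rw [← hq]
      linarith
    · rw [Finset.card_pair hab, if_neg hab, add_zero, sq]
      exact kneserEv_succ_le hn hk
  rw [hsum, ← card_sdiff_eq_sub_overlap]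
  calc ∑ a ∈ A₀.1 \ A.1, ∑ b ∈ A₀.1 \ A.1, kneserEv n k ({a, b} : Finset _).card
      ≤ ∑ a ∈ A₀.1 \ A.1, ∑ b ∈ A₀.1 \ A.1, (q ^ 2 + if a = b then q * (1 - q) else 0) :=
        Finset.sum_le_sum fun a _ => Finset.sum_le_sum fun b _ => hterm a b
    _ = ∑ a ∈ A₀.1 \ A.1, ((A₀.1 \ A.1).card * q ^ 2 + q * (1 - q)) := by
        refine Finset.sum_congr rfl fun a ha => ?_
        rw [Finset.sum_add_distrib, Finset.sum_ite_eq, if_pos ha, Finset.sum_const, nsmul_eq_mul]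
    _ = (q * (A₀.1 \ A.1).card) ^ 2 + q * (1 - q) * (A₀.1 \ A.1).card := by
        rw [Finset.sum_const, nsmul_eq_mul]
        ring

theorem one_sub_worstTV_kneserWalk_le (hn : 1 ≤ n) (hk : 1 ≤ k) (t : ℕ) :
    (1 - worstTV (kneserWalk n k) (uniformDist _) t) * (kneserEv n k 1 ^ (2 * t) * n) ≤ 32 := by
  obtain ⟨A₀⟩ := kneserVertex_nonempty n k
  have hP := kneserWalk_mem_rowStochastic (k := k) hn
  have hstat := (isStationaryDist_iff_of_tendsto hP (kneserWalk_isSymm hn)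
    (tendsto_kneserWalk_pow hn hk) _).2 rfl
  set q := kneserEv n k 1 with hq
  have hq0 : 0 ≤ q := kneserEv_nonneg 1
  have hq1 : q < 1 := kneserEv_one_lt_one hk
  have hn0 : (1 : ℝ) ≤ n := by exact_mod_cast hn
  -- the stationary mean of the overlap, which makes `f` an eigenfunction
  set a : ℝ := q * n / (1 + q) with ha
  have ha' : a * (1 + q) = q * n := by rw [ha]; field_simp
  set f : KneserVertex n k → ℝ := fun B => overlap A₀ B - a with hfdef
  have hf : (kneserWalk n k).mulVec f = (-q) • f := by
    have : f = overlap A₀ - fun _ => a := rfl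
    rw [this, Matrix.mulVec_sub, mulVec_const_of_mem_rowStochastic hP]
    funext A
    simp only [Pi.sub_apply, Pi.smul_apply, smul_eq_mul, kneserWalk_mulVec_overlap hn]
    linear_combination -ha'
  have hf2 : (kneserWalk n k).mulVec (f ^ 2)
      ≤ fun A => (-q) ^ 2 * f A ^ 2 + (1 - (-q) ^ 2) * n := by
    intro A
    have hexp : f ^ 2 = overlap A₀ ^ 2 - (2 * a) • overlap A₀ + fun _ => a ^ 2 := by
      funext B
      simp only [hfdef, Pi.pow_apply, Pi.add_apply, Pi.sub_apply, Pi.smul_apply, smul_eq_mul]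
      ring
    rw [hexp, Matrix.mulVec_add, Matrix.mulVec_sub, Matrix.mulVec_smul,
      mulVec_const_of_mem_rowStochastic hP]
    simp only [Pi.add_apply, Pi.sub_apply, Pi.smul_apply, smul_eq_mul,
      kneserWalk_mulVec_overlap hn]
    have h1 := kneserWalk_mulVec_overlap_sq_le hn hk A₀ A
    rw [← hq] at h1 ⊢
    have hy0 : 0 ≤ overlap A₀ A := Nat.cast_nonneg _
    have h2 : q * (1 - q) * (n - overlap A₀ A) ≤ (1 - q ^ 2) * n := by
      have h3 : q * (1 - q) * (n - overlap A₀ A) ≤ q * (1 - q) * n :=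
        mul_le_mul_of_nonneg_left (by linarith) (mul_nonneg hq0 (by linarith))
      nlinarith [mul_nonneg (sub_nonneg.2 hq1.le) (show (0 : ℝ) ≤ n by linarith)]
    have h4 : (q * (n - overlap A₀ A)) ^ 2 - 2 * a * (q * (n - overlap A₀ A)) + a ^ 2
        = (-q) ^ 2 * (overlap A₀ A - a) ^ 2 := by
      have : q * (n - overlap A₀ A) - a = -q * (overlap A₀ A - a) := by linear_combination -ha'
      calc _ = (q * (n - overlap A₀ A) - a) ^ 2 := by ring
        _ = _ := by rw [this]; ring
    rw [neg_sq] at h4 ⊢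
    simp only [hfdef]
    linarith
  have hmain := sq_mul_one_sub_worstTV_le hP hstat (by rw [neg_sq]; nlinarith)
    (by linarith : (0 : ℝ) ≤ n) hf hf2 t A₀
  have hfA : (n : ℝ) / 2 ≤ f A₀ := by
    simp only [hfdef, overlap_self]
    have : a ≤ n / 2 := by
      rw [ha, div_le_div_iff₀ (by linarith) two_pos]; nlinarith
    linarith
  have hsq : q ^ (2 * t) * (n / 2) ^ 2 ≤ ((-q) ^ t * f A₀) ^ 2 := by
    rw [mul_pow, ← pow_mul, mul_comm t 2, pow_mul (-q), neg_sq, ← pow_mul]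
    have : ((n : ℝ) / 2) ^ 2 ≤ f A₀ ^ 2 := pow_le_pow_left₀ (by linarith) hfA 2
    exact mul_le_mul_of_nonneg_left this (by positivity)
  have hd : 0 ≤ 1 - worstTV (kneserWalk n k) (uniformDist _) t :=
    sub_nonneg.2 (worstTV_le_one hP uniformDist_nonneg sum_uniformDist t)
  have h5 := (mul_le_mul_of_nonneg_right hsq hd).trans hmain
  have h6 : ((1 - worstTV (kneserWalk n k) (uniformDist _) t) * (q ^ (2 * t) * n)) * n
      ≤ 32 * n := by linarith
  exact le_of_mul_le_mul_right h6 (by linarith)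

end KneserLower

/-! ### Cutoff from two-sided bounds -/

section CutoffCriterion

variable {Ω : ℕ → Type} [∀ n, Fintype (Ω n)] [∀ n, DecidableEq (Ω n)] [∀ n, Nonempty (Ω n)]
  {P : ∀ n, Matrix (Ω n) (Ω n) ℝ} {π : ∀ n, Ω n → ℝ} {τ w : ℕ → ℝ} {ψ φ : ℝ → ℝ}

theorem exists_abs_mixTime_sub_le (hP : ∀ᶠ n in atTop, P n ∈ Matrix.rowStochastic ℝ (Ω n))
    (hw : ∀ᶠ n in atTop, 0 ≤ w n) (hτ : ∀ᶠ n in atTop, 0 ≤ τ n)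
    (hψ : Tendsto ψ atTop (𝓝 0)) (hφ : Tendsto φ atTop (𝓝 0))
    (hlow : ∀ c, 0 ≤ c → ∀ᶠ n in atTop, 1 - ψ c ≤ worstTVReal (P n) (π n) (τ n - c * w n))
    (hupp : ∀ c, 0 ≤ c → ∀ᶠ n in atTop, worstTVReal (P n) (π n) (τ n + c * w n) ≤ φ c)
    {ε : ℝ} (h0 : 0 < ε) (h1 : ε < 1) :
    ∃ c : ℝ, ∀ᶠ n in atTop, |(mixTime (P n) (π n) ε : ℝ) - τ n| ≤ c * w n := by
  obtain ⟨c, hψc, hφc, hc⟩ := ((hψ.eventually_lt_const (sub_pos.2 h1)).and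
    ((hφ.eventually_lt_const h0).and (eventually_ge_atTop 0))).exists
  refine ⟨c, ?_⟩
  filter_upwards [hP, hw, hτ, hlow c hc, hupp c hc] with n hPn hwn hτn hl hu
  have hlt : worstTV (P n) (π n) ⌊τ n + c * w n⌋₊ < ε := hu.trans_lt hφc
  have hge : ε ≤ worstTV (P n) (π n) ⌊τ n - c * w n⌋₊ := by
    unfold worstTVReal at hl; linarith
  have hle : (mixTime (P n) (π n) ε : ℝ) ≤ τ n + c * w n :=
    (Nat.cast_le.2 (mixTime_le hlt)).trans
      (Nat.floor_le (add_nonneg hτn (mul_nonneg hc hwn)))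
  have hgt : τ n - c * w n ≤ mixTime (P n) (π n) ε :=
    (Nat.lt_floor_add_one _).le.trans (by exact_mod_cast lt_mixTime hPn hlt hge)
  rw [abs_le]
  constructor <;> linarith

/-- Bounds on the distance `c` windows before and after `τ` which tend to `1` and `0` as `c → ∞`
give a cutoff at `τ`, provided that the window is `o(τ)`. -/
theorem hasCutoff_and_hasCutoffAt_of_bounds
    (hP : ∀ᶠ n in atTop, P n ∈ Matrix.rowStochastic ℝ (Ω n))
    (hπ : ∀ n x, 0 ≤ π n x) (hπ1 : ∀ n, ∑ x, π n x = 1)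
    (hw : ∀ᶠ n in atTop, 0 ≤ w n) (hτ : ∀ᶠ n in atTop, 0 < τ n) (hwτ : w =o[atTop] τ)
    (hψ : Tendsto ψ atTop (𝓝 0)) (hφ : Tendsto φ atTop (𝓝 0))
    (hlow : ∀ c, 0 ≤ c → ∀ᶠ n in atTop, 1 - ψ c ≤ worstTVReal (P n) (π n) (τ n - c * w n))
    (hupp : ∀ c, 0 ≤ c → ∀ᶠ n in atTop, worstTVReal (P n) (π n) (τ n + c * w n) ≤ φ c) :
    HasCutoff P π ∧ HasCutoffAt P π τ w := by
  have hequiv : ∀ ε : ℝ, 0 < ε → ε < 1 →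
      (fun n => (mixTime (P n) (π n) ε : ℝ)) ~[atTop] τ := by
    intro ε h0 h1
    obtain ⟨c, hc⟩ := exists_abs_mixTime_sub_le hP hw (hτ.mono fun _ h => h.le) hψ hφ hlow hupp
      h0 h1
    refine IsBigO.trans_isLittleO (IsBigO.of_bound c ?_) hwτ
    filter_upwards [hc, hw] with n hn hwn
    rw [Real.norm_eq_abs, Real.norm_eq_abs, abs_of_nonneg hwn]
    exact hn
  have hle1 : ∀ᶠ n in atTop, ∀ s, worstTVReal (P n) (π n) s ≤ 1 :=
    hP.mono fun n hn s => worstTV_le_one hn (hπ n) (hπ1 n) _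
  have hge0 : ∀ n s, 0 ≤ worstTVReal (P n) (π n) s := fun n s => worstTV_nonneg _ _ _
  have hbelow : ∀ s : ℕ → ℝ,
      IsBoundedUnder (· ≥ ·) atTop fun n => worstTVReal (P n) (π n) (s n) := fun s =>
    isBoundedUnder_of ⟨0, fun n => hge0 n _⟩
  have habove : ∀ s : ℕ → ℝ,
      IsBoundedUnder (· ≤ ·) atTop fun n => worstTVReal (P n) (π n) (s n) := fun s =>
    isBoundedUnder_of_eventually_le (hle1.mono fun n h => h (s n))
  refine ⟨fun ε h0 h1 => ?_, ⟨?_, ?_, ?_⟩⟩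
  · have hne : ∀ᶠ n in atTop, τ n ≠ 0 := hτ.mono fun _ h => h.ne'
    have ha := (isEquivalent_iff_tendsto_one hne).1 (hequiv ε h0 h1)
    have hb := (isEquivalent_iff_tendsto_one hne).1
      (hequiv (1 - ε) (by linarith) (by linarith))
    have hab := ha.div hb one_ne_zero
    rw [div_one] at hab
    refine hab.congr' ?_
    filter_upwards [hne] with n hn
    exact div_div_div_cancel_right₀ hn _ _
  · exact hwτ.trans_isBigO (hequiv (1 / 4) (by norm_num) (by norm_num)).symm.isBigO
  · have hlim : Tendsto (fun c => 1 - ψ c) atTop (𝓝 1) := by simpa using hψ.const_sub 1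
    refine tendsto_of_tendsto_of_tendsto_of_le_of_le' hlim tendsto_const_nhds ?_ ?_
    · filter_upwards [eventually_ge_atTop 0] with c hc
      exact le_liminf_of_le (habove _).isCoboundedUnder_ge (hlow c hc)
    · refine Eventually.of_forall fun c => liminf_le_of_le (hbelow _) fun b hb => ?_
      obtain ⟨n, hn, hn1⟩ := (hb.and hle1).exists
      exact hn.trans (hn1 _)
  · refine tendsto_of_tendsto_of_tendsto_of_le_of_le' tendsto_const_nhds hφ ?_ ?_
    · refine Eventually.of_forall fun c => le_limsup_of_le (habove _) fun b hb => ?_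
      obtain ⟨n, hn⟩ := hb.exists
      exact (hge0 n _).trans hn
    · filter_upwards [eventually_ge_atTop 0] with c hc
      exact limsup_le_of_le (hbelow _).isCoboundedUnder_le (hupp c hc)

end CutoffCriterion

/-! ### Cutoff for the Kneser walks -/

section KneserCutoff

variable {n k : ℕ} {C : ℝ}

theorem log_one_add_ge {x : ℝ} (hx : 0 ≤ x) (hxC : x ≤ C) :
    x / (1 + C) ≤ Real.log (1 + x) := by
  have h1 := Real.one_sub_inv_le_log_of_pos (show 0 < 1 + x by linarith)
  refine le_trans ?_ h1
  have h2 : 1 - (1 + x)⁻¹ = x / (1 + x) := by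
    have : 1 + x ≠ 0 := by linarith
    field_simp
    ring
  rw [h2]
  exact div_le_div_of_nonneg_left hx (by linarith) (by linarith)

theorem kneserEv_one_pow_eq_exp (hn : 1 ≤ n) (m : ℕ) :
    kneserEv n k 1 ^ (2 * m) = Real.exp (-(2 * m * Real.log (1 + (k : ℝ) / n))) := by
  have hn' : (0 : ℝ) < n := by exact_mod_cast hn
  have hpos : 0 < 1 + (k : ℝ) / n := by positivity
  have hev : kneserEv n k 1 = (1 + (k : ℝ) / n)⁻¹ := by
    rw [kneserEv_one]
    field_simp
  rw [hev, Real.exp_neg, inv_pow, ← Real.exp_log hpos, ← Real.exp_nat_mul, Real.log_exp]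
  push_cast
  rfl

/-- The cutoff time and the window satisfy `w log (2n + k) / 2 ≤ τ`, because
`log (1 + x) ≤ x`. -/
theorem window_mul_log_le (hn : 1 ≤ n) (hk : 1 ≤ k) :
    (n : ℝ) / k * (Real.log (2 * n + k) / 2)
      ≤ 1 / 2 * Real.logb (1 + (k : ℝ) / n) (2 * n + k) := by
  have hn' : (1 : ℝ) ≤ n := by exact_mod_cast hn
  have hk' : (1 : ℝ) ≤ k := by exact_mod_cast hk
  have hx : 0 < (k : ℝ) / n := by positivity
  have hL : 0 < Real.log (1 + (k : ℝ) / n) := Real.log_pos (by linarith)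
  have hLx : Real.log (1 + (k : ℝ) / n) ≤ k / n := by
    have := Real.log_le_sub_one_of_pos (show 0 < 1 + (k : ℝ) / n by linarith)
    linarith
  have hN : 0 ≤ Real.log (2 * n + k) := Real.log_nonneg (by linarith)
  have h1 : (n : ℝ) / k ≤ 1 / Real.log (1 + (k : ℝ) / n) := by
    rw [← one_div_div]
    exact one_div_le_one_div_of_le hL hLx
  have h2 := mul_le_mul_of_nonneg_right h1 hN
  rw [Real.logb]
  calc _ = (n : ℝ) / k * Real.log (2 * n + k) / 2 := by ring
    _ ≤ 1 / Real.log (1 + (k : ℝ) / n) * Real.log (2 * n + k) / 2 := by linarith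
    _ = _ := by ring

/-- At the cutoff time shifted by `c` windows, the factor `(1 + k / n) ^ (-2 s)` is
`(1 + k / n) ^ (-2 c n / k) / (2n + k)`. -/
theorem two_mul_shifted_time_mul_log (hn : 1 ≤ n) (hk : 1 ≤ k) (c : ℝ) :
    2 * (1 / 2 * Real.logb (1 + (k : ℝ) / n) (2 * n + k) + c * (n / k))
        * Real.log (1 + (k : ℝ) / n)
      = Real.log (2 * n + k) + 2 * c * (Real.log (1 + (k : ℝ) / n) / (k / n)) := by
  have hn' : (1 : ℝ) ≤ n := by exact_mod_cast hn
  have hk' : (1 : ℝ) ≤ k := by exact_mod_cast hk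
  have hx : 0 < (k : ℝ) / n := by positivity
  have hL : Real.log (1 + (k : ℝ) / n) ≠ 0 := (Real.log_pos (by linarith)).ne'
  rw [Real.logb]
  generalize Real.log (1 + (k : ℝ) / n) = L at hL
  field_simp

theorem one_div_le_log_div (hn : 1 ≤ n) (hk : 1 ≤ k) (hC : (k : ℝ) / n ≤ C) :
    1 / (1 + C) ≤ Real.log (1 + (k : ℝ) / n) / (k / n) := by
  have hn' : (1 : ℝ) ≤ n := by exact_mod_cast hn
  have hk' : (1 : ℝ) ≤ k := by exact_mod_cast hk
  have hx : 0 < (k : ℝ) / n := by positivity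
  rw [le_div_iff₀ hx, one_div_mul_eq_div]
  exact log_one_add_ge hx.le hC

theorem le_worstTVReal_kneserWalk (hn : 1 ≤ n) (hk : 1 ≤ k) (hC : (k : ℝ) / n ≤ C) {c : ℝ}
    (hc : 0 ≤ c) (hN : 2 * c ≤ Real.log (2 * n + k)) :
    1 - 32 * (2 + C) * Real.exp (-(2 * c / (1 + C)))
      ≤ worstTVReal (kneserWalk n k) (uniformDist _)
          (1 / 2 * Real.logb (1 + (k : ℝ) / n) (2 * n + k) - c * (n / k)) := by
  have hn' : (1 : ℝ) ≤ n := by exact_mod_cast hn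
  have hk' : (1 : ℝ) ≤ k := by exact_mod_cast hk
  have hx : 0 < (k : ℝ) / n := by positivity
  have hL : 0 < Real.log (1 + (k : ℝ) / n) := Real.log_pos (by linarith)
  have htime := two_mul_shifted_time_mul_log hn hk (-c)
  rw [neg_mul, ← sub_eq_add_neg] at htime
  set s := 1 / 2 * Real.logb (1 + (k : ℝ) / n) (2 * n + k) - c * (n / k) with hs
  -- at a negative time `⌊s⌋₊ = 0` would exceed `s`
  have hs0 : 0 ≤ s := by
    have h1 := window_mul_log_le hn hk
    have h2 : c * ((n : ℝ) / k) ≤ (n : ℝ) / k * (Real.log (2 * n + k) / 2) := by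
      rw [mul_comm]
      exact mul_le_mul_of_nonneg_left (by linarith) (by positivity)
    linarith
  have hfl : (⌊s⌋₊ : ℝ) ≤ s := Nat.floor_le hs0
  have hlow := one_sub_worstTV_kneserWalk_le hn hk ⌊s⌋₊
  have hN0 : (0 : ℝ) < 2 * n + k := by linarith
  have hexp : Real.exp (2 * c / (1 + C)) / (2 * n + k) ≤ kneserEv n k 1 ^ (2 * ⌊s⌋₊) := by
    rw [kneserEv_one_pow_eq_exp hn]
    calc Real.exp (2 * c / (1 + C)) / (2 * n + k)
        = Real.exp (2 * c / (1 + C) - Real.log (2 * n + k)) := by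
          rw [Real.exp_sub, Real.exp_log hN0]
      _ ≤ _ := by
          refine Real.exp_le_exp.2 ?_
          have h3 := mul_le_mul_of_nonneg_right hfl hL.le
          have h4 := mul_le_mul_of_nonneg_left (one_div_le_log_div hn hk hC)
            (show 0 ≤ 2 * c by linarith)
          rw [mul_one_div] at h4
          linarith
  have hd : 0 ≤ 1 - worstTV (kneserWalk n k) (uniformDist _) ⌊s⌋₊ :=
    sub_nonneg.2 (worstTV_le_one (kneserWalk_mem_rowStochastic hn) uniformDist_nonneg
      sum_uniformDist _)
  have hratio : (1 : ℝ) / (2 + C) ≤ n / (2 * n + k) := by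
    rw [div_le_div_iff₀ (by linarith) hN0]
    have := (div_le_iff₀ (by linarith : (0 : ℝ) < n)).1 hC
    linarith
  have h5 : Real.exp (2 * c / (1 + C)) * (1 / (2 + C)) ≤ kneserEv n k 1 ^ (2 * ⌊s⌋₊) * n := by
    calc _ ≤ Real.exp (2 * c / (1 + C)) * (n / (2 * n + k)) :=
          mul_le_mul_of_nonneg_left hratio (Real.exp_pos _).le
      _ = Real.exp (2 * c / (1 + C)) / (2 * n + k) * n := by ring
      _ ≤ _ := mul_le_mul_of_nonneg_right hexp (by linarith)
  have h6 := (mul_le_mul_of_nonneg_left h5 hd).trans hlow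
  have hC2 : 0 < 2 + C := by linarith
  have h7 : 1 - worstTV (kneserWalk n k) (uniformDist _) ⌊s⌋₊
      ≤ 32 * (2 + C) * Real.exp (-(2 * c / (1 + C))) := by
    rw [Real.exp_neg, ← div_eq_mul_inv, le_div_iff₀ (Real.exp_pos _)]
    rw [mul_one_div, mul_div_assoc', div_le_iff₀ hC2] at h6
    exact h6
  unfold worstTVReal
  linarith

theorem worstTVReal_kneserWalk_le (hn : 1 ≤ n) (hk : 1 ≤ k) (hC : (k : ℝ) / n ≤ C) {c : ℝ}
    (hc : 0 ≤ c) :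
    worstTVReal (kneserWalk n k) (uniformDist _)
        (1 / 2 * Real.logb (1 + (k : ℝ) / n) (2 * n + k) + c * (n / k))
      ≤ √(Real.exp ((1 + C) ^ 2 * Real.exp (-(2 * c / (1 + C)))) - 1) := by
  have hn' : (1 : ℝ) ≤ n := by exact_mod_cast hn
  have hk' : (1 : ℝ) ≤ k := by exact_mod_cast hk
  have hx : 0 < (k : ℝ) / n := by positivity
  have hL : 0 < Real.log (1 + (k : ℝ) / n) := Real.log_pos (by linarith)
  have htime := two_mul_shifted_time_mul_log hn hk c
  set s := 1 / 2 * Real.logb (1 + (k : ℝ) / n) (2 * n + k) + c * (n / k) with hs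
  -- rounding down costs at most one step, that is, a factor `(1 + k / n) ^ 2 ≤ (1 + C) ^ 2`
  have hfl : s - 1 ≤ (⌊s⌋₊ : ℝ) := (Nat.sub_one_lt_floor s).le
  have hN0 : (0 : ℝ) < 2 * n + k := by linarith
  refine Real.le_sqrt_of_sq_le ((worstTV_kneserWalk_sq_le hn hk _).trans ?_)
  refine sub_le_sub_right (Real.exp_le_exp.2 ?_) 1
  rw [kneserEv_one_pow_eq_exp hn]
  calc (2 * n + k) * Real.exp (-(2 * ⌊s⌋₊ * Real.log (1 + (k : ℝ) / n)))
      ≤ (2 * n + k) * Real.exp (2 * Real.log (1 + (k : ℝ) / n) - 2 * c / (1 + C)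
          - Real.log (2 * n + k)) := by
        refine mul_le_mul_of_nonneg_left (Real.exp_le_exp.2 ?_) hN0.le
        have h3 := mul_le_mul_of_nonneg_right hfl hL.le
        have h4 := mul_le_mul_of_nonneg_left (one_div_le_log_div hn hk hC)
          (show 0 ≤ 2 * c by linarith)
        rw [mul_one_div] at h4
        linarith
    _ = (1 + (k : ℝ) / n) ^ 2 * Real.exp (-(2 * c / (1 + C))) := by
        have h5 : Real.exp (2 * Real.log (1 + (k : ℝ) / n)) = (1 + (k : ℝ) / n) ^ 2 := by
          rw [two_mul, Real.exp_add, Real.exp_log (by linarith), sq]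
        rw [Real.exp_sub, sub_eq_add_neg, Real.exp_add, h5, Real.exp_log hN0]
        field_simp
    _ ≤ (1 + C) ^ 2 * Real.exp (-(2 * c / (1 + C))) :=
        mul_le_mul_of_nonneg_right (pow_le_pow_left₀ (by linarith) (by linarith) 2)
          (Real.exp_pos _).le

theorem tendsto_exp_neg_two_mul_div (hC : 0 < C) :
    Tendsto (fun c : ℝ => Real.exp (-(2 * c / (1 + C)))) atTop (𝓝 0) := by
  refine Real.tendsto_exp_neg_atTop_nhds_zero.comp ?_
  exact (tendsto_id.const_mul_atTop two_pos).atTop_div_const (by linarith)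

end KneserCutoff

theorem theorem1 (k : ℕ → ℕ) (hk_pos : ∀ n, 1 ≤ n → 1 ≤ k n)
    (hk : (fun n => (k n : ℝ)) =O[atTop] (fun n : ℕ => (n : ℝ))) :
    (∀ n, 1 ≤ n →
      IsErgodicChain (kneserWalk n (k n)) ∧
      ∀ μ : KneserVertex n (k n) → ℝ,
        IsStationaryDist (kneserWalk n (k n)) μ ↔ μ = uniformDist (KneserVertex n (k n))) ∧
    HasCutoff (fun n => kneserWalk n (k n)) (fun n => uniformDist (KneserVertex n (k n))) ∧
    HasCutoffAt (fun n => kneserWalk n (k n)) (fun n => uniformDist (KneserVertex n (k n)))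
      (fun n => (1 / 2) * Real.logb (1 + (k n : ℝ) / n) (2 * n + k n))
      (fun n => (n : ℝ) / k n) := by
  refine ⟨fun n hn => ?_, ?_⟩
  · have hP := kneserWalk_mem_rowStochastic (k := k n) hn
    have hlim := tendsto_kneserWalk_pow hn (hk_pos n hn)
    exact ⟨isErgodicChain_of_tendsto hP hlim,
      isStationaryDist_iff_of_tendsto hP (kneserWalk_isSymm hn) hlim⟩
  obtain ⟨C, hC, hkC⟩ := hk.exists_pos
  have hkC' : ∀ᶠ n : ℕ in atTop, (k n : ℝ) / n ≤ C := by
    filter_upwards [hkC.bound, eventually_ge_atTop 1] with n hb hn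
    rw [Real.norm_natCast, Real.norm_natCast] at hb
    rwa [div_le_iff₀ (by exact_mod_cast hn)]
  have hlog : Tendsto (fun n : ℕ => Real.log (2 * n + k n)) atTop atTop := by
    refine tendsto_atTop_mono' _ ?_ (Real.tendsto_log_atTop.comp tendsto_natCast_atTop_atTop)
    filter_upwards [eventually_ge_atTop 1] with n hn
    have hn' : (1 : ℝ) ≤ n := by exact_mod_cast hn
    exact Real.log_le_log (by linarith) (by linarith [Nat.cast_nonneg (α := ℝ) (k n)])
  have hexp := tendsto_exp_neg_two_mul_div hC
  refine hasCutoff_and_hasCutoffAt_of_bounds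
    (ψ := fun c => 32 * (2 + C) * Real.exp (-(2 * c / (1 + C))))
    (φ := fun c => √(Real.exp ((1 + C) ^ 2 * Real.exp (-(2 * c / (1 + C)))) - 1))
    ?_ (fun _ => uniformDist_nonneg) (fun _ => sum_uniformDist) ?_ ?_ ?_ ?_ ?_ ?_ ?_
  · filter_upwards [eventually_ge_atTop 1] with n hn
    exact kneserWalk_mem_rowStochastic hn
  · exact Eventually.of_forall fun n => by positivity
  · filter_upwards [eventually_ge_atTop 1] with n hn
    have hn' : (1 : ℝ) ≤ n := by exact_mod_cast hn
    have hk' : (1 : ℝ) ≤ k n := by exact_mod_cast hk_pos n hn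
    have hx : 0 < (k n : ℝ) / n := by positivity
    exact mul_pos one_half_pos (Real.logb_pos (by linarith) (by linarith))
  · refine isLittleO_iff.2 fun ε hε => ?_
    filter_upwards [eventually_ge_atTop 1, hlog.eventually_ge_atTop (2 / ε)] with n hn hN
    have h1 := window_mul_log_le hn (hk_pos n hn)
    have hw : (0 : ℝ) ≤ n / k n := by positivity
    rw [div_le_iff₀ hε] at hN
    rw [Real.norm_of_nonneg hw]
    refine le_trans ?_ (mul_le_mul_of_nonneg_left (h1.trans (le_abs_self _)) hε.le)
    nlinarith
  · simpa using hexp.const_mul (32 * (2 + C))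
  · have h1 := hexp.const_mul ((1 + C) ^ 2)
    rw [mul_zero] at h1
    simpa using (((Real.continuous_exp.tendsto 0).comp h1).sub_const 1).sqrt
  · intro c hc
    filter_upwards [eventually_ge_atTop 1, hkC', hlog.eventually_ge_atTop (2 * c)]
      with n hn hCn hN
    exact le_worstTVReal_kneserWalk hn (hk_pos n hn) hCn hc hN
  · intro c hc
    filter_upwards [eventually_ge_atTop 1, hkC'] with n hn hCn
    exact worstTVReal_kneserWalk_le hn (hk_pos n hn) hCn hc
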